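/- \textbf{Setting.} Let $n\ge 1$ and let $G=(N,E)$ be a directed tree on the buses $N=\{0,1,\dots,n\}$, rooted at $0$ with edges pointing away from the root; $\pi(j)$ is the parent of $j\neq 0$, and each line is $(\pi(j),j)$. Each line $(i,j)$ has resistance $r_{ij}\ge 0$ and reactance $x_{ij}\ge 0$. The variables are the sending-end powers $p_{ij},q_{ij}$ and squared current magnitudes $\ell_{ij}\ge 0$ of the lines (stacked in $\overline p,\overline q,\ell\in\mathbb R^n$), and the squared voltage magnitudes $v_i\ge 0$ and net power demands $p_i,q_i$ of the buses. Let $A^i,A^o\in\{0,1\}^{(n+1)\times n}$ be the matrices with $A^i_{k,(i,j)}=1$ iff $k=j$ and $A^o_{k,(i,j)}=1$ iff $k=i$; put $A=A^o-A^i$, and let $A_2,A^o_2$ be $A,A^o$ with the row of bus $0$ removed. $[y]$ denotes the diagonal matrix with diagonal $y$. The relaxed branch flow equations are $$p=A^i(\overline p-[r]\ell)-A^o\overline p,\qquad q=A^i(\overline q-[x]\ell)-A^o\overline q,$$ $$A^{iT}v=A^{oT}v-2([r]\overline p+[x]\overline q)+([r]^2+[x]^2)\ell,\qquad [A^{oT}v]\ell=[\overline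 p]\overline p+[\overline q]\overline q,$$ written as $\varphi(u,\xi)=0$ with variables $u=(\overline p,\overline q,\ell,v_{1\dots n},p_0,q_0)\in\mathbb R^{4n+2}$ and parameters $\xi=(v_0,p_{1\dots n},q_{1\dots n})\in\mathbb R^{2n+1}$; bus $0$ is a slack bus, $v_0=1$. Let $\varphi_u=\partial\varphi/\partial u$, and define the reduced power flow Jacobian $$\varphi_u'=[A^{oT}v]+2[\overline p]A_2^{-1}[r]+2[\overline q]A_2^{-1}[x]-[\ell]A_2^{oT}(A_2^T)^{-1}\big([r]^2+2[r]A_2^{-1}[r]+[x]^2+2[x]A_2^{-1}[x]\big)\in\mathbb R^{n\times n}.$$ An \emph{operating point} is a solution $(u,\xi)$ with $v_0=1$, all $v_i,\ell_{ij}\ge0$, and $p_j,q_j\ge 0$ for $j=1,\dots,n$. The \emph{flat voltage solution} is the operating point with $v=\mathbf 1$ and all other quantities $0$. The \emph{voltage stability region} is the connected component containing the flat voltage solution of the set of operating points at which $\det\varphi_u\neq0$. For a square matrix $M$, let $M_{\rm diag}$ and $M_{\rm off}$ be its diagonal and off-diagonal parts and $\rho(M)$ its spectral radius. Put $$\mathrm{VSI}=\frac{\ln\det\varphi_u'}{n},\qquad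 \mathrm{VSIA}=\frac1n\ln\prod_{j=1}^n\varphi'_{u,jj},\qquad \rho=\rho\big((\varphi'_{u,\rm diag})^{-1}\varphi'_{u,\rm off}\big).$$ \textbf{Theorem.} At every point of the voltage stability region at which all demands $p_j,q_j$ $(j=1,\dots,n)$ are positive, one has $\det\varphi_u'>0$, $\varphi'_{u,jj}>0$ for all $j$, and $\rho<1$ (so that the quantities above are well defined), and $$\mathrm{VSI}\;\le\;\mathrm{VSIA}\;\le\;\mathrm{VSI}-\rho\,\ln(1-\rho).$$ -/

import Mathlib

open scoped Matrix

noncomputable section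

namespace RadialGrid

/-- A radial distribution network with root `0` (the substation) and `n` further buses
`1, …, n`.  The buses are `Fin (n + 1)`.  Every bus other than the root has a unique parent,
and every bus is reached from the root along parent-to-child edges, so that the edges
`(parent e, e.succ)` form a directed tree rooted at `0`.  An edge is indexed by its child:
`e : Fin n` is the line from `parent e` to the bus `e.succ`.
`r e` and `x e` are the resistance and the reactance of that line. -/
structure Network (n : ℕ) where
  parent : Fin n → Fin (n + 1)
  rooted : ∀ j : Fin (n + 1),
    Relation.ReflTransGen (fun a b => ∃ e : Fin n, a = parent e ∧ b = e.succ) 0 j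
  r : Fin n → ℝ
  x : Fin n → ℝ
  r_nonneg : ∀ e, 0 ≤ r e
  x_nonneg : ∀ e, 0 ≤ x e

/-- Index set of the unknowns: line active powers, line reactive powers, squared line
currents, squared voltages at the buses `1, …, n`, and the two powers at the root. -/
abbrev VarIdx (n : ℕ) := Fin n ⊕ Fin n ⊕ Fin n ⊕ Fin n ⊕ Fin 1 ⊕ Fin 1

/-- Index set of the parameters: squared voltage at the root, active demands and reactive
demands at the buses `1, …, n`. -/
abbrev ParIdx (n : ℕ) := Fin 1 ⊕ Fin n ⊕ Fin n

/-- Index set of the equations: active balance and reactive balance at every bus, voltage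
drop and current equation on every line. -/
abbrev EqIdx (n : ℕ) := Fin (n + 1) ⊕ Fin (n + 1) ⊕ Fin n ⊕ Fin n

/-- The vector of the system variables. -/
abbrev Vars (n : ℕ) := VarIdx n → ℝ

/-- The vector of the system parameters. -/
abbrev Params (n : ℕ) := ParIdx n → ℝ

section Coordinates

variable {n : ℕ}

/-- Sending-end active power on each line. -/
def pLine (u : Vars n) : Fin n → ℝ := fun e => u (.inl e)

/-- Sending-end reactive power on each line. -/
def qLine (u : Vars n) : Fin n → ℝ := fun e => u (.inr (.inl e))

/-- Squared current magnitude on each line. -/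
def cur (u : Vars n) : Fin n → ℝ := fun e => u (.inr (.inr (.inl e)))

/-- Squared voltage magnitude at each bus. -/
def volt (u : Vars n) (ξ : Params n) : Fin (n + 1) → ℝ :=
  Fin.cons (ξ (.inl 0)) (fun e => u (.inr (.inr (.inr (.inl e)))))

/-- Net active power demand at each bus. -/
def pBus (u : Vars n) (ξ : Params n) : Fin (n + 1) → ℝ :=
  Fin.cons (u (.inr (.inr (.inr (.inr (.inl 0)))))) (fun e => ξ (.inr (.inl e)))

/-- Net reactive power demand at each bus. -/
def qBus (u : Vars n) (ξ : Params n) : Fin (n + 1) → ℝ :=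
  Fin.cons (u (.inr (.inr (.inr (.inr (.inr 0)))))) (fun e => ξ (.inr (.inr e)))

end Coordinates

namespace Network

variable {n : ℕ} (G : Network n)

/-- The matrix selecting, for each bus, the line that enters it. -/
def Ain (_G : Network n) : Matrix (Fin (n + 1)) (Fin n) ℝ :=
  Matrix.of fun j e => if j = e.succ then 1 else 0

/-- The matrix selecting, for each bus, the lines that leave it. -/
def Aout : Matrix (Fin (n + 1)) (Fin n) ℝ :=
  Matrix.of fun i e => if i = G.parent e then 1 else 0

/-- The incidence matrix. -/
def A : Matrix (Fin (n + 1)) (Fin n) ℝ := G.Aout - G.Ain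

/-- `Aout` without the row of the root. -/
def Aout₂ : Matrix (Fin n) (Fin n) ℝ := G.Aout.submatrix Fin.succ id

/-- The incidence matrix without the row of the root. -/
def A₂ : Matrix (Fin n) (Fin n) ℝ := G.A.submatrix Fin.succ id

/-- The residual of the relaxed branch flow equations. -/
def phi (u : Vars n) (ξ : Params n) : EqIdx n → ℝ :=
  Sum.elim
    (G.Ain *ᵥ (pLine u - G.r * cur u) - G.Aout *ᵥ pLine u - pBus u ξ) <|
  Sum.elim
    (G.Ain *ᵥ (qLine u - G.x * cur u) - G.Aout *ᵥ qLine u - qBus u ξ) <|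
  Sum.elim
    (G.Aoutᵀ *ᵥ volt u ξ - (2 : ℝ) • (G.r * pLine u + G.x * qLine u)
      + (G.r ^ 2 + G.x ^ 2) * cur u - G.Ainᵀ *ᵥ volt u ξ)
    (pLine u * pLine u + qLine u * qLine u - (G.Aoutᵀ *ᵥ volt u ξ) * cur u)

/-- The Jacobian of `phi` with respect to the system variables, by blocks of rows and columns
(see `hasFDerivAt_phi`). -/
def jacBlocks (u : Vars n) (ξ : Params n) : Matrix (EqIdx n) (VarIdx n) ℝ :=
  Matrix.fromRows
    (Matrix.fromCols (-G.A) <| Matrix.fromCols 0 <|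
      Matrix.fromCols (-(G.Ain * Matrix.diagonal G.r)) <| Matrix.fromCols 0 <|
      Matrix.fromCols (Matrix.of fun j _ => if j = 0 then -1 else 0) 0) <|
  Matrix.fromRows
    (Matrix.fromCols 0 <| Matrix.fromCols (-G.A) <|
      Matrix.fromCols (-(G.Ain * Matrix.diagonal G.x)) <| Matrix.fromCols 0 <|
      Matrix.fromCols 0 (Matrix.of fun j _ => if j = 0 then -1 else 0)) <|
  Matrix.fromRows
    (Matrix.fromCols (-((2 : ℝ) • Matrix.diagonal G.r)) <|
      Matrix.fromCols (-((2 : ℝ) • Matrix.diagonal G.x)) <|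
      Matrix.fromCols (Matrix.diagonal G.r ^ 2 + Matrix.diagonal G.x ^ 2) <|
      Matrix.fromCols G.A₂ᵀ <| Matrix.fromCols 0 0)
    (Matrix.fromCols ((2 : ℝ) • Matrix.diagonal (pLine u)) <|
      Matrix.fromCols ((2 : ℝ) • Matrix.diagonal (qLine u)) <|
      Matrix.fromCols (-Matrix.diagonal (G.Aoutᵀ *ᵥ volt u ξ)) <|
      Matrix.fromCols (-(Matrix.diagonal (cur u) * G.Aout₂ᵀ)) <| Matrix.fromCols 0 0)

theorem volt_line (u h : Vars n) (ξ : Params n) (t : ℝ) :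
    volt (u + t • h) ξ = volt u ξ + t • volt h 0 := by
  ext i
  refine Fin.cases ?_ (fun e => ?_) i <;> simp [volt]

theorem jacBlocks_mulVec (u h : Vars n) (ξ : Params n) :
    G.jacBlocks u ξ *ᵥ h =
      Sum.elim (G.Ain *ᵥ (pLine h - G.r * cur h) - G.Aout *ᵥ pLine h - pBus h 0) (
      Sum.elim (G.Ain *ᵥ (qLine h - G.x * cur h) - G.Aout *ᵥ qLine h - qBus h 0) (
      Sum.elim
        (G.Aoutᵀ *ᵥ volt h 0 - (2 : ℝ) • (G.r * pLine h + G.x * qLine h)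
          + (G.r ^ 2 + G.x ^ 2) * cur h - G.Ainᵀ *ᵥ volt h 0)
        ((2 : ℝ) • (pLine u * pLine h + qLine u * qLine h)
          - (G.Aoutᵀ *ᵥ volt u ξ) * cur h - (G.Aoutᵀ *ᵥ volt h 0) * cur u))) := by
  have hh : h = Sum.elim (pLine h) (Sum.elim (qLine h) (Sum.elim (cur h)
      (Sum.elim (fun e => volt h 0 e.succ)
        (Sum.elim (fun _ => pBus h 0 0) (fun _ => qBus h 0 0))))) := by
    ext k
    rcases k with e | e | e | e | e | e <;> simp [pLine, qLine, cur, volt, pBus, qBus] <;>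
      rw [Subsingleton.elim e 0]
  have hd : ∀ a b : Fin n → ℝ, Matrix.diagonal a *ᵥ b = a * b := fun a b => by
    ext i; simp [Matrix.mulVec_diagonal]
  have h0 : volt h 0 0 = 0 := by simp [volt]
  have hb : ∀ B : Matrix (Fin (n + 1)) (Fin n) ℝ,
      Bᵀ *ᵥ volt h 0 = (B.submatrix Fin.succ id)ᵀ *ᵥ fun e => volt h 0 e.succ := by
    intro B; ext e
    simp [Matrix.mulVec, dotProduct, Fin.sum_univ_succ, h0]
  have hs : ((G.Aout - G.Ain).submatrix Fin.succ id)ᵀ =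
      (G.Aout.submatrix Fin.succ id)ᵀ - (G.Ain.submatrix Fin.succ id)ᵀ := rfl
  conv_lhs => rw [hh]
  simp only [jacBlocks, Matrix.fromRows_mulVec, Matrix.fromCols_mulVec_sumElim, Matrix.zero_mulVec,
    Matrix.neg_mulVec, Matrix.smul_mulVec, Matrix.add_mulVec, ← Matrix.mulVec_mulVec, hd, pow_two,
    A₂, A, Aout₂, hb, Matrix.sub_mulVec, Matrix.mulVec_sub, hs]
  congr 1
  · ext j
    refine Fin.cases ?_ (fun e => ?_) j <;>
      simp [Matrix.mulVec, dotProduct, pBus] <;> ring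
  congr 1
  · ext j
    refine Fin.cases ?_ (fun e => ?_) j <;>
      simp [Matrix.mulVec, dotProduct, qBus] <;> ring
  congr 1
  · ext j
    simp
    ring
  · ext j
    simp
    ring

theorem hasFDerivAt_phi (u : Vars n) (ξ : Params n) :
    HasFDerivAt (fun u' => G.phi u' ξ)
      (Matrix.mulVecLin (G.jacBlocks u ξ)).toContinuousLinearMap u := by
  have hdiff : DifferentiableAt ℝ (fun u' => G.phi u' ξ) u := by
    have hv : ∀ j, DifferentiableAt ℝ (fun u' => volt u' ξ j) u := fun j => by
      refine Fin.cases ?_ (fun e => ?_) j <;> simp [volt] <;> fun_prop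
    have hp : ∀ j, DifferentiableAt ℝ (fun u' => pBus u' ξ j) u := fun j => by
      refine Fin.cases ?_ (fun e => ?_) j <;> simp [pBus] <;> fun_prop
    have hq : ∀ j, DifferentiableAt ℝ (fun u' => qBus u' ξ j) u := fun j => by
      refine Fin.cases ?_ (fun e => ?_) j <;> simp [qBus] <;> fun_prop
    rw [differentiableAt_pi]
    rintro (j | j | j | j) <;>
      simp only [phi, Sum.elim_inl, Sum.elim_inr, Matrix.mulVec, dotProduct, Pi.sub_apply,
        Pi.add_apply, Pi.mul_apply, Pi.smul_apply, pLine, qLine, cur] <;> fun_prop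
  have hline : ∀ h, HasDerivAt (fun t : ℝ => G.phi (u + t • h) ξ) (G.jacBlocks u ξ *ᵥ h) 0 := by
    intro h
    have hpb : ∀ t : ℝ, pBus (u + t • h) ξ = pBus u ξ + t • pBus h 0 := fun t => by
      ext i
      refine Fin.cases ?_ (fun e => ?_) i <;> simp [pBus]
    have hqb : ∀ t : ℝ, qBus (u + t • h) ξ = qBus u ξ + t • qBus h 0 := fun t => by
      ext i
      refine Fin.cases ?_ (fun e => ?_) i <;> simp [qBus]
    have key : ∀ t : ℝ, G.phi (u + t • h) ξ = G.phi u ξ + t • (G.jacBlocks u ξ *ᵥ h)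
        + t ^ 2 • (Sum.elim 0 (Sum.elim 0 (Sum.elim 0 (pLine h * pLine h + qLine h * qLine h
          - (G.Aoutᵀ *ᵥ volt h 0) * cur h))) : EqIdx n → ℝ) := by
      intro t
      have h1 : pLine (u + t • h) = pLine u + t • pLine h := rfl
      have h2 : qLine (u + t • h) = qLine u + t • qLine h := rfl
      have h3 : cur (u + t • h) = cur u + t • cur h := rfl
      have h4 : G.r * (cur u + t • cur h) = G.r * cur u + t • (G.r * cur h) := by
        ext i; simp; ring
      have h5 : G.x * (cur u + t • cur h) = G.x * cur u + t • (G.x * cur h) := by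
        ext i; simp; ring
      rw [jacBlocks_mulVec]
      ext k
      rcases k with j | j | j | j <;>
        simp [phi, volt_line, hpb, hqb, h1, h2, h3, h4, h5, Matrix.mulVec_add, Matrix.mulVec_sub,
          Matrix.mulVec_smul] <;> ring
    simp only [key]
    have := (((hasDerivAt_id (0 : ℝ)).smul_const (G.jacBlocks u ξ *ᵥ h)).const_add
      (G.phi u ξ)).add (((hasDerivAt_id (0 : ℝ)).pow 2).smul_const
      (Sum.elim 0 (Sum.elim 0 (Sum.elim 0 (pLine h * pLine h + qLine h * qLine h
          - (G.Aoutᵀ *ᵥ volt h 0) * cur h))) : EqIdx n → ℝ))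
    refine HasDerivAt.congr_deriv this ?_
    simp
  have : fderiv ℝ (fun u' => G.phi u' ξ) u =
      (Matrix.mulVecLin (G.jacBlocks u ξ)).toContinuousLinearMap := by
    refine ContinuousLinearMap.ext fun h => ?_
    have hl : HasLineDerivAt ℝ (fun u' => G.phi u' ξ) (G.jacBlocks u ξ *ᵥ h) u h := hline h
    have := hl.lineDeriv
    rw [hdiff.lineDeriv_eq_fderiv] at this
    simpa using this
  rw [← this]
  exact hdiff.hasFDerivAt

end Network

/-- The equations, numbered block after block. -/
def eqOrder (n : ℕ) : EqIdx n ≃ Fin (4 * n + 2) :=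
  ((Equiv.sumCongr (Equiv.refl _)
      ((Equiv.sumCongr (Equiv.refl _) finSumFinEquiv).trans finSumFinEquiv)).trans
    finSumFinEquiv).trans (finCongr (by ring))

/-- The variables, numbered block after block. -/
def varOrder (n : ℕ) : VarIdx n ≃ Fin (4 * n + 2) :=
  ((Equiv.sumCongr (Equiv.refl _)
      ((Equiv.sumCongr (Equiv.refl _)
        ((Equiv.sumCongr (Equiv.refl _)
          ((Equiv.sumCongr (Equiv.refl _) finSumFinEquiv).trans finSumFinEquiv)).trans
            finSumFinEquiv)).trans finSumFinEquiv)).trans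
    finSumFinEquiv).trans (finCongr (by ring))

namespace Network

variable {n : ℕ} (G : Network n)

/-- The power flow Jacobian, a square matrix of size `4 n + 2`. -/
def jac (u : Vars n) (ξ : Params n) : Matrix (Fin (4 * n + 2)) (Fin (4 * n + 2)) ℝ :=
  Matrix.reindex (eqOrder n) (varOrder n) (G.jacBlocks u ξ)

/-- The reduced power flow Jacobian. -/
def redJac (u : Vars n) (ξ : Params n) : Matrix (Fin n) (Fin n) ℝ :=
  Matrix.diagonal (G.Aoutᵀ *ᵥ volt u ξ)
    + (2 : ℝ) • (Matrix.diagonal (pLine u) * G.A₂⁻¹ * Matrix.diagonal G.r)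
    + (2 : ℝ) • (Matrix.diagonal (qLine u) * G.A₂⁻¹ * Matrix.diagonal G.x)
    - Matrix.diagonal (cur u) * G.Aout₂ᵀ * (G.A₂ᵀ)⁻¹ *
      (Matrix.diagonal G.r ^ 2 + (2 : ℝ) • (Matrix.diagonal G.r * G.A₂⁻¹ * Matrix.diagonal G.r)
        + Matrix.diagonal G.x ^ 2
        + (2 : ℝ) • (Matrix.diagonal G.x * G.A₂⁻¹ * Matrix.diagonal G.x))

/-- The operating points `(u, ξ)` of a network whose buses `1, …, n` are loads: solutions of
the relaxed branch flow equations with unit voltage at the root, nonnegative squared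
magnitudes, and no bus `1, …, n` with negative active or reactive demand.  (The demands are
allowed to vanish because they do so at the flat voltage solution.) -/
def operatingPoints : Set (Vars n × Params n) :=
  {w | G.phi w.1 w.2 = 0 ∧ volt w.1 w.2 0 = 1 ∧
    (∀ i, 0 ≤ volt w.1 w.2 i) ∧ (∀ e, 0 ≤ cur w.1 e) ∧
    (∀ e : Fin n, 0 ≤ pBus w.1 w.2 e.succ) ∧ (∀ e : Fin n, 0 ≤ qBus w.1 w.2 e.succ)}

end Network

/-- The flat voltage solution: unit voltage at every bus, everything else zero. -/
def flat (n : ℕ) : Vars n × Params n :=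
  (Sum.elim 0 <| Sum.elim 0 <| Sum.elim 0 <| Sum.elim 1 0, Sum.elim 1 0)

/-- The voltage stability region: the connected region around the flat voltage solution, in
the set of operating points, on which the power flow Jacobian is nonsingular. -/
def Network.stabilityRegion {n : ℕ} (G : Network n) : Set (Vars n × Params n) :=
  connectedComponentIn {w | w ∈ G.operatingPoints ∧ (G.jac w.1 w.2).det ≠ 0} (flat n)

section MatrixNotions

variable {n : ℕ}

/-- The diagonal part of a matrix. -/
def diagPart (M : Matrix (Fin n) (Fin n) ℝ) : Matrix (Fin n) (Fin n) ℝ :=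
  Matrix.diagonal M.diag

/-- The off-diagonal part of a matrix. -/
def offPart (M : Matrix (Fin n) (Fin n) ℝ) : Matrix (Fin n) (Fin n) ℝ :=
  M - diagPart M

/-- The spectral radius of a real matrix: the largest modulus of its complex eigenvalues. -/
def specRad (M : Matrix (Fin n) (Fin n) ℝ) : ℝ :=
  (spectralRadius ℂ (M.map (algebraMap ℝ ℂ))).toReal

end MatrixNotions

namespace Network

variable {n : ℕ} (G : Network n)

/-- The voltage stability index. -/
def VSI (u : Vars n) (ξ : Params n) : ℝ :=
  Real.log (G.redJac u ξ).det / n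

/-- The approximate voltage stability index. -/
def VSIA (u : Vars n) (ξ : Params n) : ℝ :=
  Real.log (∏ e, G.redJac u ξ e e) / n

/-- The spectral radius of the inverse diagonal part times the off-diagonal part of the reduced
power flow Jacobian. -/
def rho (u : Vars n) (ξ : Params n) : ℝ :=
  specRad ((diagPart (G.redJac u ξ))⁻¹ * offPart (G.redJac u ξ))

end Network

end RadialGrid

end

/-! Throughout the stability region the reduced Jacobian `M` is a nonsingular M-matrix; both
inequalities are then facts about M-matrices.

Off-diagonal signs: the inverse incidence matrix of the tree is entrywise nonpositive and
nonnegative demands force nonnegative flows, so `redJac_off_nonpos` holds at every operating point.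
`det_redJac_ne_zero` carries nonsingularity over from the full Jacobian. Among nonsingular matrices
with these signs, being an M-matrix is open (some positive vector has positive image) and so is its
negation (some entry of the inverse is negative). The region is connected and `M = 1` at the flat
point, whence `redJac_isMMatrix`.

The lower inequality is Hadamard's, `det_pos_and_le_prod_diag`. For the upper one write `M = D (1 +
C)` with `D` the diagonal part. `C` has trace zero and its eigenvalues `z` satisfy `‖z‖ ≤ ρ < 1`, so
`‖1 + z‖ ≥ (1 - ρ) exp (ρ + re z)`. In the product over all eigenvalues the factors `exp (re z)`
cancel, which gives `det (1 + C) ≥ ((1 - ρ) exp ρ) ^ n`; finally `log (1 - ρ) + ρ ≥ ρ log (1 - ρ)`.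
-/

namespace Matrix

/-! ### Nonsingular M-matrices and Hadamard's inequality -/

section MMatrix

variable {n : ℕ}

/-- If `M` reflects nonnegativity of vectors, then `M` is invertible with nonnegative inverse. -/
theorem inv_nonneg_of_monotone {M : Matrix (Fin n) (Fin n) ℝ}
    (hM : ∀ y, 0 ≤ M *ᵥ y → 0 ≤ y) : IsUnit M.det ∧ ∀ i j, 0 ≤ M⁻¹ i j := by
  have hdet : IsUnit M.det := by
    rw [isUnit_iff_ne_zero]
    intro h
    obtain ⟨v, hv, h0⟩ := Matrix.exists_mulVec_eq_zero_iff.mpr h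
    refine hv (le_antisymm ?_ (hM v h0.ge))
    have := hM (-v) (by rw [Matrix.mulVec_neg, h0, neg_zero])
    simpa using this
  refine ⟨hdet, fun i j => ?_⟩
  have h1 : M *ᵥ (M⁻¹ *ᵥ Pi.single j 1) = Pi.single j 1 := by
    rw [Matrix.mulVec_mulVec, Matrix.mul_nonsing_inv _ hdet, Matrix.one_mulVec]
  have h2 := hM (M⁻¹ *ᵥ Pi.single j 1) (by rw [h1]; exact Pi.single_nonneg.mpr zero_le_one) i
  simpa using h2

/-- A matrix with nonpositive off-diagonal entries that maps some positive vector to a positive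
vector, that is, a nonsingular M-matrix. -/
structure IsMMatrix (M : Matrix (Fin n) (Fin n) ℝ) : Prop where
  off_nonpos : ∀ i j, i ≠ j → M i j ≤ 0
  semipos : ∃ x : Fin n → ℝ, (∀ i, 0 < x i) ∧ ∀ i, 0 < (M *ᵥ x) i

namespace IsMMatrix

variable {M : Matrix (Fin n) (Fin n) ℝ}

theorem diag_pos (hM : M.IsMMatrix) (i : Fin n) : 0 < M i i := by
  obtain ⟨x, hx, hMx⟩ := hM.semipos
  have h := hMx i
  rw [Matrix.mulVec, dotProduct, ← Finset.add_sum_erase _ _ (Finset.mem_univ i)] at h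
  have h2 : ∑ j ∈ Finset.univ.erase i, M i j * x j ≤ 0 :=
    Finset.sum_nonpos fun j hj => mul_nonpos_of_nonpos_of_nonneg
      (hM.off_nonpos i j (Finset.ne_of_mem_erase hj).symm) (hx j).le
  exact pos_of_mul_pos_left (by linarith : 0 < M i i * x i) (hx i).le

/-- Let `c` be the least ratio `y j / x j`, attained at `i`. Then `y - c x` is nonnegative and
vanishes at `i`, so the off-diagonal signs give `(M y) i ≤ c (M x) i`, which is negative if `c < 0`.
-/
theorem monotone (hM : M.IsMMatrix) (y : Fin n → ℝ) (hy : 0 ≤ M *ᵥ y) : 0 ≤ y := by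
  obtain ⟨x, hx, hMx⟩ := hM.semipos
  by_contra hcon
  obtain ⟨k, hk⟩ : ∃ k, y k < 0 := by simpa [Pi.le_def] using hcon
  have : Nonempty (Fin n) := ⟨k⟩
  obtain ⟨i, hi⟩ := Finite.exists_min fun j => y j / x j
  set c := y i / x i with hc
  have hc0 : c < 0 := (hi k).trans_lt (div_neg_of_neg_of_pos hk (hx k))
  have hyc : ∀ j, c * x j ≤ y j := fun j => (le_div_iff₀ (hx j)).mp (hi j)
  have hyi : y i = c * x i := by rw [hc]; field_simp [(hx i).ne']
  have h1 : (M *ᵥ y) i ≤ c * (M *ᵥ x) i := by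
    simp only [Matrix.mulVec, dotProduct, Finset.mul_sum]
    refine Finset.sum_le_sum fun j _ => ?_
    by_cases hij : i = j
    · subst hij; rw [hyi]; exact le_of_eq (by ring)
    · have := mul_le_mul_of_nonpos_left (hyc j) (hM.off_nonpos i j hij)
      linarith
  have h2 := hy i
  have h3 := mul_neg_of_neg_of_pos hc0 (hMx i)
  simp only [Pi.zero_apply] at h2
  linarith

theorem isUnit_det (hM : M.IsMMatrix) : IsUnit M.det :=
  (inv_nonneg_of_monotone hM.monotone).1

theorem inv_nonneg (hM : M.IsMMatrix) (i j : Fin n) : 0 ≤ M⁻¹ i j :=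
  (inv_nonneg_of_monotone hM.monotone).2 i j

/-- A nonsingular matrix with nonpositive off-diagonal entries and nonnegative inverse is a
nonsingular M-matrix. -/
theorem of_inv_nonneg (hoff : ∀ i j, i ≠ j → M i j ≤ 0) (hdet : M.det ≠ 0)
    (hinv : ∀ i j, 0 ≤ M⁻¹ i j) : M.IsMMatrix := by
  have hu : IsUnit M.det := isUnit_iff_ne_zero.mpr hdet
  -- The row sums of the inverse serve as the positive vector, with image `1`. A zero row sum would
  -- make a whole row of the inverse vanish.
  refine ⟨hoff, M⁻¹ *ᵥ 1, fun i => ?_, fun i => ?_⟩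
  · have hnn : 0 ≤ (M⁻¹ *ᵥ 1) i := by
      simpa [Matrix.mulVec, dotProduct] using Finset.sum_nonneg fun j _ => hinv i j
    refine lt_of_le_of_ne hnn fun h0 => ?_
    have hz : ∀ j, M⁻¹ i j = 0 := by
      have : ∑ j, M⁻¹ i j = 0 := by simpa [Matrix.mulVec, dotProduct] using h0.symm
      intro j
      exact (Finset.sum_eq_zero_iff_of_nonneg fun j _ => hinv i j).mp this j (Finset.mem_univ j)
    have := congrFun (congrFun (Matrix.nonsing_inv_mul M hu) i) i
    simp [Matrix.mul_apply, hz] at this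
  · rw [Matrix.mulVec_mulVec, Matrix.mul_nonsing_inv _ hu, Matrix.one_mulVec]
    simp

/-- Deleting index `0` removes only nonpositive terms from the remaining entries of `M x`, so the
restricted vector still works. This feeds the induction in Hadamard's inequality. -/
theorem submatrix_succ {M : Matrix (Fin (n + 1)) (Fin (n + 1)) ℝ} (hM : M.IsMMatrix) :
    (M.submatrix Fin.succ Fin.succ).IsMMatrix := by
  obtain ⟨x, hx, hMx⟩ := hM.semipos
  refine ⟨fun i j hij => hM.off_nonpos _ _ (by simpa using hij), fun i => x i.succ,
    fun i => hx _, fun i => ?_⟩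
  have h := hMx i.succ
  rw [Matrix.mulVec, dotProduct, Fin.sum_univ_succ] at h
  have h2 := mul_nonpos_of_nonpos_of_nonneg
    (hM.off_nonpos i.succ 0 (Fin.succ_ne_zero i)) (hx 0).le
  simp only [Matrix.mulVec, dotProduct, Matrix.submatrix_apply]
  linarith

/-- Hadamard's determinant inequality for nonsingular M-matrices. -/
theorem det_pos_and_le_prod_diag :
    ∀ {n : ℕ} {M : Matrix (Fin n) (Fin n) ℝ}, M.IsMMatrix → 0 < M.det ∧ M.det ≤ ∏ i, M i i
  | 0, M, _ => by simp
  | n + 1, M, hM => by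
    obtain ⟨h1, h2⟩ := det_pos_and_le_prod_diag hM.submatrix_succ
    have hu := hM.isUnit_det
    have hd : 0 < M 0 0 := hM.diag_pos 0
    have hadj : M⁻¹ 0 0 = M.det⁻¹ * (M.submatrix Fin.succ Fin.succ).det := by
      rw [Matrix.inv_def, Matrix.smul_apply, Matrix.adjugate_fin_succ_eq_det_submatrix]
      simp
    -- In the corner entry of `M⁻¹ M = 1` all other terms are nonpositive. By Cramer's rule this
    -- bounds `det M` by `M 0 0` times the complementary minor.
    have hge : 1 ≤ M⁻¹ 0 0 * M 0 0 := by
      have h := congrFun (congrFun (Matrix.nonsing_inv_mul M hu) 0) 0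
      rw [Matrix.mul_apply, Fin.sum_univ_succ, Matrix.one_apply_eq] at h
      have : ∑ i : Fin n, M⁻¹ 0 i.succ * M i.succ 0 ≤ 0 :=
        Finset.sum_nonpos fun i _ => mul_nonpos_of_nonneg_of_nonpos (hM.inv_nonneg _ _)
          (hM.off_nonpos _ _ (Fin.succ_ne_zero i))
      linarith
    have hdet : 0 < M.det := by
      have h3 : 0 < M⁻¹ 0 0 := pos_of_mul_pos_left (by linarith) hd.le
      rw [hadj] at h3
      exact inv_pos.mp (pos_of_mul_pos_left h3 h1.le)
    refine ⟨hdet, ?_⟩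
    rw [hadj, mul_assoc, ← div_eq_inv_mul, le_div_iff₀ hdet, one_mul] at hge
    rw [Fin.prod_univ_succ]
    refine hge.trans ?_
    rw [mul_comm]
    exact mul_le_mul_of_nonneg_left h2 hd.le

end IsMMatrix

end MMatrix

end Matrix

/-! ### Determinants of trace-zero perturbations of the identity -/

/-- Among the complex numbers in a disc of radius `ρ < 1`, the modulus of `(1 + z) exp (-z)` is
smallest at `-ρ`. -/
theorem Complex.one_sub_mul_exp_le_norm_one_add {z : ℂ} {ρ : ℝ} (hz : ‖z‖ ≤ ρ) (hρ : ρ < 1) :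
    (1 - ρ) * Real.exp (ρ + z.re) ≤ ‖1 + z‖ := by
  have hρ0 : 0 ≤ ρ := (norm_nonneg z).trans hz
  have hz1 : ‖-z‖ < 1 := by rw [norm_neg]; exact hz.trans_lt hρ
  have hρ1 : ‖(ρ : ℂ)‖ < 1 := by simpa [abs_of_nonneg hρ0] using hρ
  have hpos : 0 < ‖1 + z‖ := by
    rw [norm_pos_iff]
    intro h
    have : z = -1 := by linear_combination h
    rw [this] at hz1
    simp at hz1
  -- The series `∑ w ^ k / k` of `-log (1 - w)` at `w = -z` and at `w = ρ` are compared term by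
  -- term. The linear term is removed from both; it is what yields `ρ + z.re`.
  have s1 := Complex.hasSum_re
    ((Complex.hasSum_taylorSeries_neg_log hz1).sub (hasSum_ite_eq 1 (-z)))
  have s2 := Complex.hasSum_re
    ((Complex.hasSum_taylorSeries_neg_log hρ1).sub (hasSum_ite_eq 1 (ρ : ℂ)))
  have hle := hasSum_le (fun k => ?_) s1 s2
  · have hρlog : (Complex.log (1 - ρ)).re = Real.log (1 - ρ) := by
      rw [Complex.log_re]
      congr 1
      rw [← Complex.ofReal_one, ← Complex.ofReal_sub, Complex.norm_real, Real.norm_eq_abs,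
        abs_of_pos (by linarith)]
    simp only [Complex.sub_re, Complex.add_re, Complex.neg_re, hρlog, Complex.ofReal_re,
      sub_neg_eq_add, Complex.log_re] at hle
    have h3 : Real.log (1 - ρ) + (ρ + z.re) ≤ Real.log ‖1 + z‖ := by linarith
    calc (1 - ρ) * Real.exp (ρ + z.re)
        = Real.exp (Real.log (1 - ρ) + (ρ + z.re)) := by
          rw [Real.exp_add (Real.log _), Real.exp_log (by linarith)]
      _ ≤ Real.exp (Real.log ‖1 + z‖) := Real.exp_le_exp.mpr h3
      _ = ‖1 + z‖ := Real.exp_log hpos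
  · by_cases hk : k = 1
    · subst hk; simp
    · simp only [hk, if_false, sub_zero]
      have h1 : ((ρ : ℂ) ^ k / k).re = ρ ^ k / k := by
        rw [← Complex.ofReal_pow, ← Complex.ofReal_natCast, ← Complex.ofReal_div,
          Complex.ofReal_re]
      rw [h1]
      refine (Complex.re_le_norm _).trans ?_
      rw [norm_div, norm_pow, norm_neg, Complex.norm_natCast]
      gcongr

/-- A lower bound for `det (1 + C)` when `C` has trace zero and its complex eigenvalues lie in a
disc of radius `ρ < 1`. -/
theorem Matrix.pow_le_abs_det_one_add {n : ℕ} (C : Matrix (Fin n) (Fin n) ℝ)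
    (htr : C.trace = 0) {ρ : ℝ} (hρ : ρ < 1)
    (hC : ∀ z ∈ spectrum ℂ (C.map (algebraMap ℝ ℂ)), ‖z‖ ≤ ρ) :
    ((1 - ρ) * Real.exp ρ) ^ n ≤ |(1 + C).det| := by
  set K : Matrix (Fin n) (Fin n) ℂ := C.map (algebraMap ℝ ℂ) with hK
  set s := K.charpoly.roots with hs
  have hsplit := IsAlgClosed.splits K.charpoly
  have hcard : s.card = n := by
    rw [hs, ← hsplit.natDegree_eq_card_roots, Matrix.charpoly_natDegree_eq_dim, Fintype.card_fin]
  have hsum : (s.map Complex.re).sum = 0 := by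
    have h1 := Matrix.trace_eq_sum_roots_charpoly K
    have h2 : K.trace = 0 := by
      have : K.trace = algebraMap ℝ ℂ C.trace := by simp [hK, Matrix.trace]
      rw [this, htr, map_zero]
    have h3 : Complex.reAddGroupHom s.sum = (s.map Complex.reAddGroupHom).sum :=
      map_multiset_sum _ _
    rw [← h1, h2] at h3
    simpa using h3.symm
  have hdet : |(1 + C).det| = (s.map fun z => ‖1 + z‖).prod := by
    have h1 : (((1 + C).det : ℝ) : ℂ) = (1 + K).det := by
      have := RingHom.map_det (algebraMap ℝ ℂ) (1 + C)
      rw [map_add, map_one] at this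
      exact this
    have h2 : (1 + K).det = (-1) ^ n * K.charpoly.eval (-1) := by
      have h4 : -(1 + K) = Matrix.scalar (Fin n) (-1 : ℂ) - K := by
        rw [map_neg, map_one]; abel
      rw [Matrix.eval_charpoly, ← h4, Matrix.det_neg, Fintype.card_fin, ← mul_assoc, ← mul_pow]
      simp
    have h3 : K.charpoly.eval (-1) = (s.map fun z => -1 - z).prod := by
      conv_lhs => rw [hsplit.eq_prod_roots_of_monic K.charpoly_monic]
      simp [Polynomial.eval_multiset_prod, Multiset.map_map, hs]
    rw [← Real.norm_eq_abs, ← Complex.norm_real, h1, h2, h3, norm_mul, norm_pow, norm_neg, norm_one, one_pow, one_mul]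
    have h5 := map_multiset_prod (normHom : ℂ →*₀ ℝ) (s.map fun z => -1 - z)
    rw [Multiset.map_map] at h5
    refine h5.trans ?_
    congr 1
    refine Multiset.map_congr rfl fun z _ => ?_
    show ‖-1 - z‖ = ‖1 + z‖
    rw [← norm_neg]; congr 1; ring
  have hprod : (s.map fun z : ℂ => (1 - ρ) * Real.exp (ρ + z.re)).prod
      = ((1 - ρ) * Real.exp ρ) ^ n := by
    have h1 : (fun z : ℂ => (1 - ρ) * Real.exp (ρ + z.re))
        = fun z : ℂ => ((1 - ρ) * Real.exp ρ) * Real.exp z.re := by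
      ext z; rw [Real.exp_add]; ring
    -- The trace condition enters here: the real parts of the eigenvalues sum to zero.
    have h2 : (s.map fun z : ℂ => Real.exp z.re).prod = 1 := by
      have := Real.exp_multiset_sum (s.map Complex.re)
      rw [hsum, Real.exp_zero, Multiset.map_map] at this
      exact this.symm
    rw [h1, Multiset.prod_map_mul, h2, mul_one, Multiset.map_const', Multiset.prod_replicate,
      hcard]
  rw [hdet, ← hprod]
  refine Multiset.prod_map_le_prod_map₀ _ _ (fun z _ => ?_) fun z hz => ?_
  · exact mul_nonneg (by linarith) (Real.exp_pos _).le
  · refine Complex.one_sub_mul_exp_le_norm_one_add (hC z ?_) hρ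
    exact Matrix.mem_spectrum_of_isRoot_charpoly (Polynomial.isRoot_of_mem_roots hz)

/-! ### Spectral radius and the logarithmic comparison -/

namespace RadialGrid

/-- If `|C| x < x` for some positive vector `x`, then the spectral radius of `C` is less than one,
and it bounds the eigenvalues of `C`. -/
theorem specRad_lt_one {n : ℕ} [Nonempty (Fin n)] {C : Matrix (Fin n) (Fin n) ℝ}
    {x : Fin n → ℝ} (hx : ∀ i, 0 < x i) (hC : ∀ i, ∑ j, |C i j| * x j < x i) :
    specRad C < 1 ∧ ∀ z ∈ spectrum ℂ (C.map (algebraMap ℝ ℂ)), ‖z‖ ≤ specRad C := by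
  obtain ⟨k, hk⟩ := Finite.exists_max fun i => (∑ j, |C i j| * x j) / x i
  -- The operator norm of `C` for the sup norm weighted by `x`; every eigenvalue is bounded by it.
  set c := (∑ j, |C k j| * x j) / x k with hc
  have hc1 : c < 1 := (div_lt_one (hx k)).mpr (hC k)
  have hc0 : 0 ≤ c := div_nonneg
    (Finset.sum_nonneg fun j _ => mul_nonneg (abs_nonneg _) (hx j).le) (hx k).le
  have hcx : ∀ i, ∑ j, |C i j| * x j ≤ c * x i := fun i => (div_le_iff₀ (hx i)).mp (hk i)
  have hbound : ∀ z ∈ spectrum ℂ (C.map (algebraMap ℝ ℂ)), ‖z‖ ≤ c := by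
    intro z hz
    rw [spectrum.mem_iff, Matrix.isUnit_iff_isUnit_det, isUnit_iff_ne_zero, not_not] at hz
    obtain ⟨v, hv, h0⟩ := Matrix.exists_mulVec_eq_zero_iff.mpr hz
    have heig : ∀ i, z * v i = ∑ j, (C i j : ℂ) * v j := by
      intro i
      have := congrFun h0 i
      rw [Matrix.sub_mulVec, Algebra.algebraMap_eq_smul_one, Matrix.smul_mulVec,
        Matrix.one_mulVec] at this
      simpa [Matrix.mulVec, dotProduct, sub_eq_zero] using this
    obtain ⟨i, hi⟩ := Finite.exists_max fun j => ‖v j‖ / x j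
    set m := ‖v i‖ / x i with hm
    have hmv : ∀ j, ‖v j‖ ≤ m * x j := fun j => (div_le_iff₀ (hx j)).mp (hi j)
    have hvi : ‖v i‖ = m * x i := by rw [hm]; field_simp [(hx i).ne']
    have hm0 : 0 < m := by
      obtain ⟨j, hj⟩ := Function.ne_iff.mp hv
      exact (div_pos (norm_pos_iff.mpr hj) (hx j)).trans_le (hi j)
    have h1 : ‖z‖ * (m * x i) ≤ c * (m * x i) := by
      calc ‖z‖ * (m * x i) = ‖z * v i‖ := by rw [norm_mul, hvi]
        _ ≤ ∑ j, ‖(C i j : ℂ) * v j‖ := by rw [heig]; exact norm_sum_le _ _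
        _ ≤ ∑ j, m * (|C i j| * x j) := by
          refine Finset.sum_le_sum fun j _ => ?_
          rw [norm_mul, Complex.norm_real, Real.norm_eq_abs]
          have := mul_le_mul_of_nonneg_left (hmv j) (abs_nonneg (C i j))
          linarith
        _ ≤ m * (c * x i) := by
          rw [← Finset.mul_sum]; exact mul_le_mul_of_nonneg_left (hcx i) hm0.le
        _ = c * (m * x i) := by ring
    exact le_of_mul_le_mul_right h1 (mul_pos hm0 (hx i))
  have hsr : spectralRadius ℂ (C.map (algebraMap ℝ ℂ)) ≤ ENNReal.ofReal c := by
    refine iSup₂_le fun z hz => ?_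
    rw [← ENNReal.ofReal_coe_nnreal]
    exact ENNReal.ofReal_le_ofReal (hbound z hz)
  refine ⟨(ENNReal.toReal_le_of_le_ofReal hc0 hsr).trans_lt hc1, fun z hz => ?_⟩
  -- Passing to `toReal` is harmless because `hsr` makes the spectral radius finite.
  have h2 : (‖z‖₊ : ENNReal) ≤ spectralRadius ℂ (C.map (algebraMap ℝ ℂ)) :=
    le_iSup₂ (f := fun (k : ℂ) (_ : k ∈ spectrum ℂ (C.map (algebraMap ℝ ℂ))) =>
      (‖k‖₊ : ENNReal)) z hz
  exact ENNReal.toReal_mono (ne_top_of_le_ne_top ENNReal.ofReal_ne_top hsr) h2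

/-- The comparison of `det M` with the product of the diagonal entries, for a nonsingular
M-matrix `M`. -/
theorem _root_.Matrix.IsMMatrix.log_prod_diag_le {n : ℕ} [Nonempty (Fin n)]
    {M : Matrix (Fin n) (Fin n) ℝ} (hM : M.IsMMatrix) :
    specRad ((diagPart M)⁻¹ * offPart M) < 1 ∧
    Real.log (∏ i, M i i) ≤ Real.log M.det
      - n * (specRad ((diagPart M)⁻¹ * offPart M) *
        Real.log (1 - specRad ((diagPart M)⁻¹ * offPart M))) := by
  set C := (diagPart M)⁻¹ * offPart M with hCdef
  have hd := hM.diag_pos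
  have hDu : IsUnit (diagPart M).det := by
    rw [isUnit_iff_ne_zero, diagPart, Matrix.det_diagonal]
    exact Finset.prod_ne_zero_iff.mpr fun i _ => (hd i).ne'
  have hDC : diagPart M * C = offPart M := by
    rw [hCdef, ← Matrix.mul_assoc, Matrix.mul_nonsing_inv _ hDu, Matrix.one_mul]
  have hCij : ∀ i j, M i i * C i j = offPart M i j := fun i j => by
    rw [← hDC, diagPart, Matrix.diagonal_mul]; rfl
  have hdiag : ∀ i, C i i = 0 := fun i => by
    have := hCij i i
    simpa [offPart, diagPart, (hd i).ne'] using this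
  have hoff : ∀ i j, i ≠ j → M i i * C i j = M i j := fun i j hij => by
    rw [hCij]; simp [offPart, diagPart, Matrix.diagonal_apply_ne _ hij]
  obtain ⟨x, hx, hMx⟩ := hM.semipos
  -- This is `M x > 0` with each row divided by its diagonal entry, since off-diagonal entries of
  -- `M` are nonpositive.
  have hCx : ∀ i, ∑ j, |C i j| * x j < x i := by
    intro i
    have h := hMx i
    rw [Matrix.mulVec, dotProduct, ← Finset.add_sum_erase _ _ (Finset.mem_univ i)] at h
    rw [← Finset.add_sum_erase _ _ (Finset.mem_univ i), hdiag, abs_zero, zero_mul, zero_add]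
    refine lt_of_mul_lt_mul_left ?_ (hd i).le
    have h2 : M i i * ∑ j ∈ Finset.univ.erase i, |C i j| * x j
        = -∑ j ∈ Finset.univ.erase i, M i j * x j := by
      rw [Finset.mul_sum, ← Finset.sum_neg_distrib]
      refine Finset.sum_congr rfl fun j hj => ?_
      have hij := (Finset.ne_of_mem_erase hj).symm
      have h3 : M i i * |C i j| = -M i j := by
        rw [← abs_of_nonpos (hM.off_nonpos i j hij), ← hoff i j hij, abs_mul, abs_of_pos (hd i)]
      rw [← mul_assoc, h3, neg_mul]
    rw [h2]; linarith
  obtain ⟨hρ, hspec⟩ := specRad_lt_one hx hCx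
  refine ⟨hρ, ?_⟩
  set ρ := specRad C
  have htr : C.trace = 0 := by simp [Matrix.trace, hdiag]
  have hlow := C.pow_le_abs_det_one_add htr hρ hspec
  have hdet : M.det = (∏ i, M i i) * (1 + C).det := by
    have h1 : M = diagPart M * (1 + C) := by
      rw [Matrix.mul_add, hDC, Matrix.mul_one, offPart]; abel
    conv_lhs => rw [h1]
    rw [Matrix.det_mul, diagPart, Matrix.det_diagonal]; rfl
  have hP : 0 < ∏ i, M i i := Finset.prod_pos fun i _ => hd i
  have hdM := hM.det_pos_and_le_prod_diag.1
  have h1C : 0 < (1 + C).det := by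
    rw [hdet] at hdM; exact pos_of_mul_pos_right hdM hP.le
  rw [abs_of_pos h1C] at hlow
  have h1ρ : 0 < 1 - ρ := by linarith
  have hlog : (n : ℝ) * (Real.log (1 - ρ) + ρ) ≤ Real.log (1 + C).det := by
    have := Real.log_le_log (pow_pos (mul_pos h1ρ (Real.exp_pos ρ)) n) hlow
    rwa [Real.log_pow, Real.log_mul h1ρ.ne' (Real.exp_pos ρ).ne', Real.log_exp] at this
  -- This is `1 - 1 / t ≤ log t` at `t = 1 - ρ`, multiplied by `t`. It weakens the bound `hlog` to
  -- the stated form.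
  have hentropy : ρ * Real.log (1 - ρ) ≤ Real.log (1 - ρ) + ρ := by
    have h := mul_le_mul_of_nonneg_left (Real.one_sub_inv_le_log_of_pos h1ρ) h1ρ.le
    rw [mul_sub, mul_inv_cancel₀ h1ρ.ne'] at h
    linarith
  have := mul_le_mul_of_nonneg_left hentropy (Nat.cast_nonneg (α := ℝ) n)
  rw [hdet, Real.log_mul hP.ne' h1C.ne']
  linarith

end RadialGrid

/-! ### Signs of the incidence inverse, the flows and the reduced Jacobian -/

namespace RadialGrid

namespace Network

variable {n : ℕ} (G : Network n)

theorem Aout₂_nonneg (i j : Fin n) : 0 ≤ G.Aout₂ i j := by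
  simp only [Aout₂, Aout, Matrix.submatrix_apply, Matrix.of_apply]
  split_ifs <;> norm_num

theorem A₂_eq : G.A₂ = G.Aout₂ - 1 := by
  ext i j
  simp [A₂, A, Aout₂, Ain, Matrix.one_apply]

theorem transpose_Aout_mulVec (v : Fin (n + 1) → ℝ) (e : Fin n) :
    (G.Aoutᵀ *ᵥ v) e = v (G.parent e) := by
  simp [Matrix.mulVec, dotProduct, Aout]

theorem transpose_Aout₂_mulVec (y : Fin n → ℝ) :
    G.Aout₂ᵀ *ᵥ y = G.Aoutᵀ *ᵥ (Fin.cons 0 y : Fin (n + 1) → ℝ) := by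
  ext e
  simp [Matrix.mulVec, dotProduct, Aout₂, Fin.sum_univ_succ]

/-- Going down the tree, a potential that vanishes at the root and does not decrease along the
edges is nonnegative. -/
theorem neg_transpose_A₂_monotone (y : Fin n → ℝ) (hy : 0 ≤ (-G.A₂ᵀ) *ᵥ y) : 0 ≤ y := by
  have h : ∀ j, 0 ≤ (Fin.cons 0 y : Fin (n + 1) → ℝ) j := by
    intro j
    induction G.rooted j with
    | refl => simp
    | tail _ hbc ih =>
      obtain ⟨e, rfl, rfl⟩ := hbc
      have he := hy e
      rw [A₂_eq, Matrix.transpose_sub, Matrix.transpose_one, neg_sub, Matrix.sub_mulVec,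
        Matrix.one_mulVec, transpose_Aout₂_mulVec, Pi.sub_apply, transpose_Aout_mulVec] at he
      simp only [Pi.zero_apply] at he
      rw [Fin.cons_succ]
      linarith
  intro e
  simpa using h e.succ

theorem isUnit_det_A₂ : IsUnit G.A₂.det := by
  have h := (Matrix.inv_nonneg_of_monotone G.neg_transpose_A₂_monotone).1
  rw [← Matrix.isUnit_iff_isUnit_det] at h ⊢
  simpa using h

theorem inv_A₂_nonpos (i j : Fin n) : G.A₂⁻¹ i j ≤ 0 := by
  have h := (Matrix.inv_nonneg_of_monotone G.neg_transpose_A₂_monotone).2 j i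
  have h2 : (-G.A₂ᵀ)⁻¹ = -(G.A₂⁻¹)ᵀ := by
    refine Matrix.inv_eq_left_inv ?_
    rw [neg_mul_neg, ← Matrix.transpose_mul, Matrix.mul_nonsing_inv _ G.isUnit_det_A₂,
      Matrix.transpose_one]
  rw [h2] at h
  simpa using h

/-- With `A₂ = Aout₂ - 1`, the diagonal of `A₂ A₂⁻¹ = 1` reads `(Aout₂ A₂⁻¹) i i - A₂⁻¹ i i = 1`,
and the first term is nonpositive. The bound lets `2 [a] A₂⁻¹ [a]` outweigh `[a]²` on the diagonal.
-/
theorem inv_A₂_diag_le (i : Fin n) : G.A₂⁻¹ i i ≤ -1 := by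
  have h := congrFun (congrFun (Matrix.mul_nonsing_inv _ G.isUnit_det_A₂) i) i
  rw [A₂_eq, sub_mul, one_mul, Matrix.one_apply_eq, Matrix.sub_apply, ← A₂_eq,
    Matrix.mul_apply] at h
  have h2 : ∑ j, G.Aout₂ i j * G.A₂⁻¹ j i ≤ 0 := Finset.sum_nonpos fun j _ =>
    mul_nonpos_of_nonneg_of_nonpos (G.Aout₂_nonneg i j) (G.inv_A₂_nonpos j i)
  linarith

/-- The matrix `[a]² + 2 [a] A₂⁻¹ [a]` is entrywise nonpositive. -/
theorem diagonal_sq_add_nonpos {a : Fin n → ℝ} (ha : ∀ e, 0 ≤ a e) (i j : Fin n) :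
    (Matrix.diagonal a ^ 2 + (2 : ℝ) • (Matrix.diagonal a * G.A₂⁻¹ * Matrix.diagonal a)) i j
      ≤ 0 := by
  simp only [Matrix.diagonal_pow, Matrix.add_apply, Matrix.smul_apply, Matrix.mul_diagonal,
    Matrix.diagonal_mul, smul_eq_mul]
  by_cases hij : i = j
  · subst hij
    have h1 := mul_le_mul_of_nonneg_left (G.inv_A₂_diag_le i) (mul_self_nonneg (a i))
    have h2 := mul_self_nonneg (a i)
    rw [Matrix.diagonal_apply_eq, Pi.pow_apply]
    nlinarith
  · rw [Matrix.diagonal_apply_ne _ hij]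
    have := mul_nonpos_of_nonneg_of_nonpos (mul_nonneg (ha i) (ha j)) (G.inv_A₂_nonpos i j)
    nlinarith

/-- The power entering the subtree below a line is nonnegative when the demands and the losses
are. -/
theorem flow_nonneg {f d : Fin n → ℝ} (hd : 0 ≤ d) (h : -G.A₂ *ᵥ f = d) (e : Fin n) :
    0 ≤ f e := by
  have hf : f = -(G.A₂⁻¹ *ᵥ d) := by
    rw [← h, Matrix.neg_mulVec, Matrix.mulVec_neg, neg_neg, Matrix.mulVec_mulVec,
      Matrix.nonsing_inv_mul _ G.isUnit_det_A₂, Matrix.one_mulVec]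
  rw [hf, Pi.neg_apply, Left.nonneg_neg_iff, Matrix.mulVec, dotProduct]
  exact Finset.sum_nonpos fun j _ => mul_nonpos_of_nonpos_of_nonneg (G.inv_A₂_nonpos e j) (hd j)

theorem Ain_mulVec_succ (f : Fin n → ℝ) (e : Fin n) : (G.Ain *ᵥ f) e.succ = f e := by
  simp [Matrix.mulVec, dotProduct, Ain]

theorem Aout_mulVec_succ (f : Fin n → ℝ) (e : Fin n) :
    (G.Aout *ᵥ f) e.succ = (G.Aout₂ *ᵥ f) e := rfl

theorem A₂_mulVec (f : Fin n → ℝ) : G.A₂ *ᵥ f = G.Aout₂ *ᵥ f - f := by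
  rw [A₂_eq, Matrix.sub_mulVec, Matrix.one_mulVec]

/-- Off the root, active balance is `-A₂ p = demand + loss`, with loss `r ℓ ≥ 0`. -/
theorem pLine_nonneg {w : Vars n × Params n} (hw : w ∈ G.operatingPoints) (e : Fin n) :
    0 ≤ pLine w.1 e := by
  obtain ⟨hphi, -, -, hcur, hp, -⟩ := hw
  refine G.flow_nonneg (d := fun e => pBus w.1 w.2 e.succ + G.r e * cur w.1 e)
    (fun e => add_nonneg (hp e) (mul_nonneg (G.r_nonneg e) (hcur e))) ?_ e
  ext e
  have h := congrFun hphi (.inl e.succ)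
  simp only [phi, Sum.elim_inl, Pi.sub_apply, Ain_mulVec_succ, Aout_mulVec_succ, Pi.mul_apply,
    Pi.zero_apply] at h
  rw [Matrix.neg_mulVec, A₂_mulVec, Pi.neg_apply, Pi.sub_apply]
  linarith

theorem qLine_nonneg {w : Vars n × Params n} (hw : w ∈ G.operatingPoints) (e : Fin n) :
    0 ≤ qLine w.1 e := by
  obtain ⟨hphi, -, -, hcur, -, hq⟩ := hw
  refine G.flow_nonneg (d := fun e => qBus w.1 w.2 e.succ + G.x e * cur w.1 e)
    (fun e => add_nonneg (hq e) (mul_nonneg (G.x_nonneg e) (hcur e))) ?_ e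
  ext e
  have h := congrFun hphi (.inr (.inl e.succ))
  simp only [phi, Sum.elim_inl, Sum.elim_inr, Pi.sub_apply, Ain_mulVec_succ, Aout_mulVec_succ,
    Pi.mul_apply, Pi.zero_apply] at h
  rw [Matrix.neg_mulVec, A₂_mulVec, Pi.neg_apply, Pi.sub_apply]
  linarith

/-- The voltage term is diagonal and the two flow terms carry the sign of `A₂⁻¹`. In the current
term two nonpositive matrices are multiplied, and the product is subtracted. -/
theorem redJac_off_nonpos {w : Vars n × Params n} (hw : w ∈ G.operatingPoints) (i j : Fin n)
    (hij : i ≠ j) : G.redJac w.1 w.2 i j ≤ 0 := by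
  have hp := G.pLine_nonneg hw i
  have hq := G.qLine_nonneg hw i
  have hl : 0 ≤ cur w.1 i := hw.2.2.2.1 i
  set K := Matrix.diagonal G.r ^ 2
    + (2 : ℝ) • (Matrix.diagonal G.r * G.A₂⁻¹ * Matrix.diagonal G.r)
    + Matrix.diagonal G.x ^ 2 + (2 : ℝ) • (Matrix.diagonal G.x * G.A₂⁻¹ * Matrix.diagonal G.x)
    with hK
  have hKn : ∀ i j, K i j ≤ 0 := fun i j => by
    rw [hK, add_assoc (_ + _), Matrix.add_apply]
    exact add_nonpos (G.diagonal_sq_add_nonpos G.r_nonneg i j)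
      (G.diagonal_sq_add_nonpos G.x_nonneg i j)
  have hS : ∀ i j, (G.Aout₂ᵀ * (G.A₂ᵀ)⁻¹) i j ≤ 0 := fun i j => by
    rw [← Matrix.transpose_nonsing_inv, Matrix.mul_apply]
    exact Finset.sum_nonpos fun k _ =>
      mul_nonpos_of_nonneg_of_nonpos (G.Aout₂_nonneg k i) (G.inv_A₂_nonpos j k)
  have h1 : 0 ≤ (Matrix.diagonal (cur w.1) * G.Aout₂ᵀ * (G.A₂ᵀ)⁻¹ * K) i j := by
    rw [Matrix.mul_assoc (Matrix.diagonal _), Matrix.mul_assoc, Matrix.diagonal_mul,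
      Matrix.mul_apply]
    exact mul_nonneg hl (Finset.sum_nonneg fun k _ => mul_nonneg_of_nonpos_of_nonpos
      (hS i k) (hKn k j))
  have h2 : pLine w.1 i * G.A₂⁻¹ i j * G.r j ≤ 0 := mul_nonpos_of_nonpos_of_nonneg
    (mul_nonpos_of_nonneg_of_nonpos hp (G.inv_A₂_nonpos i j)) (G.r_nonneg j)
  have h3 : qLine w.1 i * G.A₂⁻¹ i j * G.x j ≤ 0 := mul_nonpos_of_nonpos_of_nonneg
    (mul_nonpos_of_nonneg_of_nonpos hq (G.inv_A₂_nonpos i j)) (G.x_nonneg j)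
  rw [redJac, ← hK]
  simp only [Matrix.add_apply, Matrix.sub_apply, Matrix.smul_apply, Matrix.mul_diagonal,
    Matrix.diagonal_mul, smul_eq_mul, Matrix.diagonal_apply_ne _ hij]
  simp only [Matrix.mul_assoc, Matrix.diagonal_mul] at h1 ⊢
  linarith

/-! ### From the full Jacobian to the reduced one -/

/-- A kernel vector of the reduced Jacobian extends to a kernel vector of the full Jacobian. -/
theorem det_redJac_ne_zero {u : Vars n} {ξ : Params n} (h : (G.jac u ξ).det ≠ 0) :
    (G.redJac u ξ).det ≠ 0 := by
  intro h0
  obtain ⟨l, hl, hker⟩ := Matrix.exists_mulVec_eq_zero_iff.mpr h0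
  have hA := G.isUnit_det_A₂
  have hAT : IsUnit (G.A₂ᵀ).det := by rwa [Matrix.det_transpose]
  -- For a given current direction `l`, the linearised balances determine `a` and `b`, the voltage
  -- drop then determines `v`, and the root powers absorb the balance at bus `0`.
  set a : Fin n → ℝ := -(G.A₂⁻¹ *ᵥ (G.r * l)) with ha
  set b : Fin n → ℝ := -(G.A₂⁻¹ *ᵥ (G.x * l)) with hb
  set v : Fin n → ℝ := (G.A₂ᵀ)⁻¹ *ᵥ ((2 : ℝ) • (G.r * a + G.x * b) - (G.r ^ 2 + G.x ^ 2) * l)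
    with hv
  have hAa : G.A₂ *ᵥ a = -(G.r * l) := by
    rw [ha, Matrix.mulVec_neg, Matrix.mulVec_mulVec, Matrix.mul_nonsing_inv _ hA,
      Matrix.one_mulVec]
  have hAb : G.A₂ *ᵥ b = -(G.x * l) := by
    rw [hb, Matrix.mulVec_neg, Matrix.mulVec_mulVec, Matrix.mul_nonsing_inv _ hA,
      Matrix.one_mulVec]
  have hAv : G.A₂ᵀ *ᵥ v = (2 : ℝ) • (G.r * a + G.x * b) - (G.r ^ 2 + G.x ^ 2) * l := by
    rw [hv, Matrix.mulVec_mulVec, Matrix.mul_nonsing_inv _ hAT, Matrix.one_mulVec]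
  set p₀ := (G.Ain *ᵥ (a - G.r * l) - G.Aout *ᵥ a) 0 with hp₀
  set q₀ := (G.Ain *ᵥ (b - G.x * l) - G.Aout *ᵥ b) 0 with hq₀
  set z : Vars n := Sum.elim a (Sum.elim b (Sum.elim l (Sum.elim v
    (Sum.elim (fun _ => p₀) (fun _ => q₀))))) with hz
  have hz1 : pLine z = a := rfl
  have hz2 : qLine z = b := rfl
  have hz3 : cur z = l := rfl
  have hz4 : volt z 0 = Fin.cons 0 v := rfl
  have hz5 : pBus z 0 = Fin.cons p₀ 0 := rfl
  have hz6 : qBus z 0 = Fin.cons q₀ 0 := rfl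
  have hd : ∀ a b : Fin n → ℝ, Matrix.diagonal a *ᵥ b = a * b := fun a b => by
    ext i; simp [Matrix.mulVec_diagonal]
  have hAin : G.Ainᵀ *ᵥ (Fin.cons 0 v : Fin (n + 1) → ℝ) = v := by
    ext e; simp [Matrix.mulVec, dotProduct, Ain]
  have hjz : G.jacBlocks u ξ *ᵥ z = 0 := by
    rw [jacBlocks_mulVec, hz1, hz2, hz3, hz4, hz5, hz6]
    have h1 : G.Ain *ᵥ (a - G.r * l) - G.Aout *ᵥ a - (Fin.cons p₀ 0 : Fin (n + 1) → ℝ) = 0 := by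
      ext j
      refine Fin.cases ?_ (fun e => ?_) j
      · simp [hp₀]
      · have := congrFun hAa e
        rw [A₂_mulVec] at this
        simp only [Pi.sub_apply, Ain_mulVec_succ, Aout_mulVec_succ, Pi.mul_apply, Pi.zero_apply,
          Pi.neg_apply, Fin.cons_succ] at this ⊢
        linarith
    have h2 : G.Ain *ᵥ (b - G.x * l) - G.Aout *ᵥ b - (Fin.cons q₀ 0 : Fin (n + 1) → ℝ) = 0 := by
      ext j
      refine Fin.cases ?_ (fun e => ?_) j
      · simp [hq₀]
      · have := congrFun hAb e
        rw [A₂_mulVec] at this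
        simp only [Pi.sub_apply, Ain_mulVec_succ, Aout_mulVec_succ, Pi.mul_apply, Pi.zero_apply,
          Pi.neg_apply, Fin.cons_succ] at this ⊢
        linarith
    have h3 : G.Aoutᵀ *ᵥ (Fin.cons 0 v : Fin (n + 1) → ℝ) - (2 : ℝ) • (G.r * a + G.x * b)
        + (G.r ^ 2 + G.x ^ 2) * l - G.Ainᵀ *ᵥ (Fin.cons 0 v : Fin (n + 1) → ℝ) = 0 := by
      rw [A₂_eq, Matrix.transpose_sub, Matrix.transpose_one, Matrix.sub_mulVec,
        Matrix.one_mulVec, transpose_Aout₂_mulVec] at hAv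
      rw [hAin, eq_add_of_sub_eq hAv]
      abel
    -- After elimination the linearised current equation is `-(redJac *ᵥ l) = 0`.
    have h4 : (2 : ℝ) • (pLine u * a + qLine u * b) - (G.Aoutᵀ *ᵥ volt u ξ) * l
        - (G.Aoutᵀ *ᵥ (Fin.cons 0 v : Fin (n + 1) → ℝ)) * cur u = 0 := by
      rw [← transpose_Aout₂_mulVec]
      have hv' : v = -((G.A₂ᵀ)⁻¹ *ᵥ (G.r * (G.r * l)
          + (2 : ℝ) • (G.r * (G.A₂⁻¹ *ᵥ (G.r * l))) + G.x * (G.x * l)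
          + (2 : ℝ) • (G.x * (G.A₂⁻¹ *ᵥ (G.x * l))))) := by
        rw [hv, ← Matrix.mulVec_neg]
        congr 1
        ext e
        simp [ha, hb]
        ring
      rw [redJac] at hker
      simp only [Matrix.add_mulVec, Matrix.sub_mulVec, Matrix.smul_mulVec, ← Matrix.mulVec_mulVec,
        hd, pow_two] at hker
      rw [hv', Matrix.mulVec_neg]
      ext e
      have := congrFun hker e
      simp [ha, hb] at this ⊢
      linarith
    rw [h1, h2, h3, h4]
    ext k
    rcases k with k | k | k | k <;> rfl
  refine h (Matrix.exists_mulVec_eq_zero_iff.mp ⟨z ∘ (varOrder n).symm, fun hz0 => hl ?_, ?_⟩)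
  · have : z = 0 := by
      ext k
      simpa using congrFun hz0 (varOrder n k)
    rw [← hz3, this]; rfl
  · rw [jac, Matrix.reindex_apply, Matrix.submatrix_mulVec_equiv, Function.comp_assoc]
    simp [hjz]

/-! ### Connectedness argument -/

theorem continuous_redJac : Continuous fun w : Vars n × Params n => G.redJac w.1 w.2 := by
  have hv : Continuous fun w : Vars n × Params n => volt w.1 w.2 := by
    refine continuous_pi fun j => ?_
    refine Fin.cases ?_ (fun e => ?_) j <;> simp only [volt, Fin.cons_zero, Fin.cons_succ] <;>
      fun_prop
  have hp : Continuous fun w : Vars n × Params n => pLine w.1 := by unfold pLine; fun_prop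
  have hq : Continuous fun w : Vars n × Params n => qLine w.1 := by unfold qLine; fun_prop
  have hc : Continuous fun w : Vars n × Params n => cur w.1 := by unfold cur; fun_prop
  unfold redJac
  fun_prop

theorem redJac_flat : G.redJac (flat n).1 (flat n).2 = 1 := by
  have h1 : pLine (flat n).1 = 0 := rfl
  have h2 : qLine (flat n).1 = 0 := rfl
  have h3 : cur (flat n).1 = 0 := rfl
  have h4 : G.Aoutᵀ *ᵥ volt (flat n).1 (flat n).2 = 1 := by
    ext e
    rw [transpose_Aout_mulVec]
    refine Fin.cases ?_ (fun j => ?_) (G.parent e) <;> simp [volt, flat]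
  rw [redJac, h1, h2, h3, h4]
  simp

/-- In the voltage stability region the reduced Jacobian is a nonsingular M-matrix. -/
theorem redJac_isMMatrix {w : Vars n × Params n} (hw : w ∈ G.stabilityRegion) :
    (G.redJac w.1 w.2).IsMMatrix := by
  have hsub : ∀ w ∈ G.stabilityRegion, w ∈ G.operatingPoints ∧ (G.redJac w.1 w.2).det ≠ 0 := by
    intro w hw
    have h := connectedComponentIn_subset _ _ hw
    exact ⟨h.1, G.det_redJac_ne_zero h.2⟩
  -- `connectedComponentIn` is empty unless its base point lies in the set, so `w` itself certifies
  -- the flat point.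
  have hflat : flat n ∈ G.stabilityRegion :=
    mem_connectedComponentIn (connectedComponentIn_nonempty_iff.mp ⟨w, hw⟩)
  have hcont := G.continuous_redJac
  set P : Set (Vars n × Params n) :=
    {w | ∃ x : Fin n → ℝ, (∀ i, 0 < x i) ∧ ∀ i, 0 < (G.redJac w.1 w.2 *ᵥ x) i} with hP
  -- `det * adjugate` has the signs of the inverse but is polynomial in the entries, so openness
  -- follows without dividing.
  set Q : Set (Vars n × Params n) := {w | ∃ i j, (G.redJac w.1 w.2).det *
    (G.redJac w.1 w.2).adjugate i j < 0} with hQ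
  have hPopen : IsOpen P := by
    have : P = ⋃ x : Fin n → ℝ, ⋃ _ : ∀ i, 0 < x i, ⋂ i, {w | 0 < (G.redJac w.1 w.2 *ᵥ x) i} := by
      ext w; simp [hP]
    rw [this]
    refine isOpen_iUnion fun x => isOpen_iUnion fun _ => isOpen_iInter_of_finite fun i => ?_
    exact isOpen_lt continuous_const
      ((continuous_apply i).comp (hcont.matrix_mulVec continuous_const))
  have hQopen : IsOpen Q := by
    have : Q = ⋃ i, ⋃ j, {w | (G.redJac w.1 w.2).det * (G.redJac w.1 w.2).adjugate i j < 0} := by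
      ext w; simp [hQ]
    rw [this]
    refine isOpen_iUnion fun i => isOpen_iUnion fun j => ?_
    exact isOpen_lt (hcont.matrix_det.mul (hcont.matrix_adjugate.matrix_elem i j)) continuous_const
  have hinv : ∀ (M : Matrix (Fin n) (Fin n) ℝ), M.det ≠ 0 → ∀ i j,
      M.det * M.adjugate i j = M.det ^ 2 * M⁻¹ i j := by
    intro M hM i j
    rw [Matrix.inv_def, Matrix.smul_apply, smul_eq_mul, Ring.inverse_eq_inv']
    field_simp
  have hnotQ : ∀ w ∈ G.stabilityRegion, w ∉ Q → (G.redJac w.1 w.2).IsMMatrix := by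
    intro w hw hwQ
    obtain ⟨hop, hdet⟩ := hsub w hw
    refine .of_inv_nonneg (G.redJac_off_nonpos hop) hdet fun i j => ?_
    by_contra hneg
    refine hwQ ⟨i, j, ?_⟩
    rw [hinv _ hdet]
    exact mul_neg_of_pos_of_neg (by positivity) (not_le.mp hneg)
  refine hnotQ w hw fun hwQ => ?_
  -- `P` and `Q` cover the region, and `P` contains the flat point. If `Q` were met too, a common
  -- point would be an M-matrix whose inverse has a negative entry.
  obtain ⟨w', hw', hwP', i, j, hij⟩ := isPreconnected_connectedComponentIn P Q hPopen hQopen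
    (fun w hw => by
      by_cases hwQ : w ∈ Q
      · exact .inr hwQ
      · exact .inl (hnotQ w hw hwQ).semipos)
    ⟨flat n, hflat, 1, fun _ => one_pos, fun i => by simp [G.redJac_flat]⟩ ⟨w, hw, hwQ⟩
  obtain ⟨hop, hdet⟩ := hsub w' hw'
  have hM : (G.redJac w'.1 w'.2).IsMMatrix := ⟨G.redJac_off_nonpos hop, hwP'⟩
  rw [hinv _ hdet] at hij
  exact absurd hij (not_lt.mpr (mul_nonneg (sq_nonneg _) (hM.inv_nonneg i j)))

end Network

end RadialGrid

theorem mainTheorem5 (n : ℕ) (hn : 1 ≤ n) (G : RadialGrid.Network n)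
    (u : RadialGrid.Vars n) (ξ : RadialGrid.Params n)
    (hw : (u, ξ) ∈ G.stabilityRegion)
    (hp : ∀ e : Fin n, 0 < RadialGrid.pBus u ξ e.succ)
    (hq : ∀ e : Fin n, 0 < RadialGrid.qBus u ξ e.succ) :
    0 < (G.redJac u ξ).det ∧ (∀ e, 0 < G.redJac u ξ e e) ∧ G.rho u ξ < 1 ∧
      G.VSI u ξ ≤ G.VSIA u ξ ∧
      G.VSIA u ξ ≤ G.VSI u ξ - G.rho u ξ * Real.log (1 - G.rho u ξ) := by
  have hM : (G.redJac u ξ).IsMMatrix := G.redJac_isMMatrix (w := (u, ξ)) hw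
  have : Nonempty (Fin n) := ⟨⟨0, hn⟩⟩
  have hn0 : (0 : ℝ) < n := by exact_mod_cast hn
  obtain ⟨hdet, hle⟩ := hM.det_pos_and_le_prod_diag
  obtain ⟨hρ, hlog⟩ := hM.log_prod_diag_le
  refine ⟨hdet, fun e => hM.diag_pos e, hρ, ?_, ?_⟩
  · exact div_le_div_of_nonneg_right (Real.log_le_log hdet hle) hn0.le
  · rw [RadialGrid.Network.VSIA, RadialGrid.Network.VSI, div_le_iff₀ hn0, sub_mul,
      div_mul_cancel₀ _ hn0.ne', RadialGrid.Network.rho]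
    linarith
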